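/- Let $n\ge 1$, let $H$ be a complex Hilbert space, let $f\in L^1(\mathbb R^n;H)\cap L^2(\mathbb R^n;H)$, and let $$\hat f(\xi)=(2\pi)^{-n/2}\int_{\mathbb R^n}e^{-i x\cdot\xi}f(x)\,dx,\qquad \xi\in\mathbb R^n,$$ be its Fourier transform. (i) (Beurling–Hörmander type uncertainty principle.) If $$\int_{\mathbb R^n}\int_{\mathbb R^n}\|f(x)\|_H\,\|\hat f(\xi)\|_H\,e^{|x\cdot\xi|}\,dx\,d\xi<\infty,$$ then $f=0$ almost everywhere. (ii) (Morgan type uncertainty principle.) Let $p\in(1,2)$, $\frac1p+\frac1q=1$, and $\alpha,\beta>0$ with $\alpha\beta>1$. If $$\int_{\mathbb R^n}\|f(x)\|_H\,e^{\alpha^p|x|^p/p}\,dx+\int_{\mathbb R^n}\|\hat f(\xi)\|_H\,e^{\beta^q|\xi|^q/q}\,d\xi<\infty,$$ then $f=0$ almost everywhere. -/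

import Mathlib

open MeasureTheory

noncomputable section

/-- The unitary Fourier transform in angular frequency of a vector-valued function on `ℝⁿ`,
`f̂(ξ) = (2π)^(-n/2) ∫ e^(-i x·ξ) f(x) dx` (Bochner integral). Mathlib's `𝓕` uses the
kernel `e^(-2πi x·ξ)` instead, which would change the weight `e^|x·ξ|`. -/
def angularFourier {n : ℕ} {H : Type*} [NormedAddCommGroup H] [NormedSpace ℂ H]
    (f : EuclideanSpace ℝ (Fin n) → H) (ξ : EuclideanSpace ℝ (Fin n)) : H :=
  ((2 * Real.pi) ^ (-(n : ℝ) / 2) : ℝ) •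
    ∫ x, Complex.exp (-(Complex.I * (inner ℝ x ξ : ℝ))) • f x

end

/-!
Hörmander's argument. Fix a direction and let `φ` be the restriction of the Fourier transform of `f`
to that line. The Fourier transform `h` of `φ` times a Gaussian is entire of order two and bounded
by an increasing function `M` of `|im z|`, while on the real line it is a Gaussian average of `f`,
so Beurling's condition makes `‖h‖ M` integrable there. Hence `∫₀^z h(u) h(iu) du` is bounded for
`z` on the coordinate axes, by Phragmén–Lindelöf on all of `ℂ`, and is constant by Liouville:
`h(z) h(iz)` vanishes identically, and so do `h` and `φ`. Polar coordinates give the condition on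
almost every line through the origin, up to a power weight. Morgan's condition implies Beurling's
by Young's inequality.
-/

section EntireFunctions

open Complex Set

/-- The growth class of entire functions of order at most two and finite type. The summand `1`
in the exponent absorbs constant factors. -/
def HasOrderTwoGrowth (h : ℂ → ℂ) : Prop :=
  ∃ A : ℝ, ∀ z, ‖h z‖ ≤ Real.exp (A * (1 + ‖z‖ ^ 2))

/-- The integral of `k` along the segment from `0` to `z`, which is a primitive of `k` if `k` is
entire. -/
noncomputable def segmentIntegral (k : ℂ → ℂ) (z : ℂ) : ℂ :=
  ∫ t in (0 : ℝ)..1, k (t * z) * z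

namespace HasOrderTwoGrowth

variable {k k₁ k₂ : ℂ → ℂ}

theorem mul (h₁ : HasOrderTwoGrowth k₁) (h₂ : HasOrderTwoGrowth k₂) :
    HasOrderTwoGrowth fun z => k₁ z * k₂ z := by
  obtain ⟨A₁, hA₁⟩ := h₁
  obtain ⟨A₂, hA₂⟩ := h₂
  refine ⟨A₁ + A₂, fun z => ?_⟩
  rw [norm_mul, add_mul, Real.exp_add]
  gcongr
  exacts [hA₁ z, hA₂ z]

theorem comp_const_mul (hk : HasOrderTwoGrowth k) (c : ℂ) :
    HasOrderTwoGrowth fun z => k (c * z) := by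
  obtain ⟨A, hA⟩ := hk
  refine ⟨|A| * (1 + ‖c‖ ^ 2), fun z => (hA (c * z)).trans (Real.exp_le_exp.2 ?_)⟩
  calc A * (1 + ‖c * z‖ ^ 2) ≤ |A| * (1 + ‖c * z‖ ^ 2) := by gcongr; exact le_abs_self A
    _ ≤ |A| * ((1 + ‖c‖ ^ 2) * (1 + ‖z‖ ^ 2)) := by
        gcongr
        rw [norm_mul, mul_pow]
        nlinarith [sq_nonneg ‖c‖, sq_nonneg ‖z‖]
    _ = |A| * (1 + ‖c‖ ^ 2) * (1 + ‖z‖ ^ 2) := by ring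

theorem segmentIntegral (hk : HasOrderTwoGrowth k) : HasOrderTwoGrowth (segmentIntegral k) := by
  obtain ⟨A, hA⟩ := hk
  refine ⟨|A| + 1, fun z => ?_⟩
  have hz : ‖z‖ ≤ Real.exp (1 + ‖z‖ ^ 2) := by
    nlinarith [Real.add_one_le_exp (1 + ‖z‖ ^ 2), sq_nonneg (‖z‖ - 1)]
  have hbound : ∀ t ∈ uIoc (0 : ℝ) 1, ‖k (t * z) * z‖ ≤ Real.exp ((|A| + 1) * (1 + ‖z‖ ^ 2)) := by
    intro t ht
    rw [uIoc_of_le zero_le_one] at ht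
    have htz : ‖(t : ℂ) * z‖ ≤ ‖z‖ := by
      rw [norm_mul, norm_real, Real.norm_of_nonneg ht.1.le]
      exact mul_le_of_le_one_left (norm_nonneg z) ht.2
    have hktz : ‖k (t * z)‖ ≤ Real.exp (|A| * (1 + ‖z‖ ^ 2)) := by
      refine (hA _).trans (Real.exp_le_exp.2 ?_)
      gcongr
      exact le_abs_self A
    rw [norm_mul, add_mul, one_mul, Real.exp_add]
    gcongr
  simpa [_root_.segmentIntegral] using
    intervalIntegral.norm_integral_le_of_norm_le_const hbound

end HasOrderTwoGrowth

theorem hasDerivAt_segmentIntegral {k : ℂ → ℂ} (hk : Differentiable ℂ k) (z : ℂ) :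
    HasDerivAt (segmentIntegral k) (k z) z := by
  obtain ⟨G, hG⟩ := hk.isExactOn_univ
  have hG' (w : ℂ) : HasDerivAt G (k w) w := hG w (mem_univ w)
  have hray (w : ℂ) (t : ℝ) : HasDerivAt (fun t : ℝ => G (t * w)) (k (t * w) * w) t := by
    have hmul : HasDerivAt (fun t : ℂ => t * w) w (t : ℂ) := by
      simpa using (hasDerivAt_id (t : ℂ)).mul_const w
    exact ((hG' (t * w)).comp (t : ℂ) hmul).comp_ofReal
  have hseg : segmentIntegral k = fun w => G w - G 0 := by
    funext w
    have hcont : Continuous fun t : ℝ => k (t * w) * w := by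
      have := hk.continuous
      fun_prop
    rw [segmentIntegral, intervalIntegral.integral_eq_sub_of_hasDerivAt (fun t _ => hray w t)
      (hcont.intervalIntegrable 0 1)]
    simp
  rw [hseg]
  exact (hG' z).sub_const _

theorem differentiable_segmentIntegral {k : ℂ → ℂ} (hk : Differentiable ℂ k) :
    Differentiable ℂ (segmentIntegral k) :=
  fun z => (hasDerivAt_segmentIntegral hk z).differentiableAt

theorem segmentIntegral_const_mul (k : ℂ → ℂ) (c z : ℂ) :
    segmentIntegral k (c * z) = c * segmentIntegral (fun u => k (c * u)) z := by
  simp only [segmentIntegral, ← intervalIntegral.integral_const_mul]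
  congr 1 with t
  rw [mul_left_comm (t : ℂ) c z]
  ring

theorem norm_segmentIntegral_le_integral {k : ℂ → ℂ} {g : ℝ → ℝ} (hg : Integrable g)
    (hg₀ : 0 ≤ g) {e : ℂ} (he : ‖e‖ = 1) (hkg : ∀ u : ℝ, 0 ≤ u → ‖k (u * e)‖ ≤ g u)
    {s : ℝ} (hs : 0 ≤ s) :
    ‖segmentIntegral k (s * e)‖ ≤ ∫ u, g u := by
  have hray : segmentIntegral k (s * e) = ∫ u in (0 : ℝ)..s, k (u * e) * e := by
    have := intervalIntegral.smul_integral_comp_mul_left (a := 0) (b := 1)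
      (fun u : ℝ => k (u * e) * e) s
    rw [mul_zero, mul_one, real_smul] at this
    rw [← this, segmentIntegral_const_mul, segmentIntegral]
    simp only [ofReal_mul, mul_assoc]
  calc ‖segmentIntegral k (s * e)‖ ≤ ∫ u in (0 : ℝ)..s, g u := by
        rw [hray]
        refine intervalIntegral.norm_integral_le_of_norm_le hs (.of_forall fun u hu => ?_)
          hg.intervalIntegrable
        rw [norm_mul, he, mul_one]
        exact hkg u hu.1.le
    _ = ∫ u in Ioc 0 s, g u := intervalIntegral.integral_of_le hs
    _ ≤ ∫ u, g u := setIntegral_le_integral hg (.of_forall hg₀)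

theorem norm_le_of_norm_le_on_sector_boundary {G : ℂ → ℂ} (hG : Differentiable ℂ G)
    (hgrowth : HasOrderTwoGrowth G) {a b B : ℝ} (hab : b - a < Real.pi / 2)
    (ha : ∀ s : ℝ, 0 ≤ s → ‖G (s * exp (a * I))‖ ≤ B)
    (hb : ∀ s : ℝ, 0 ≤ s → ‖G (s * exp (b * I))‖ ≤ B)
    {θ : ℝ} (hθ : θ ∈ Icc a b) {s : ℝ} (hs : 0 ≤ s) : ‖G (s * exp (θ * I))‖ ≤ B := by
  obtain rfl | hlt := (hθ.1.trans hθ.2).eq_or_lt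
  · simpa [le_antisymm hθ.2 hθ.1] using ha s hs
  obtain rfl | hs := hs.eq_or_lt
  · simpa using ha 0 le_rfl
  have hexp (w : ℂ) : exp w = (Real.exp w.re : ℝ) * exp (w.im * I) := by
    rw [ofReal_exp, ← exp_add, re_add_im]
  obtain ⟨A, hA⟩ := hgrowth
  -- The exponential maps the strip `a ≤ im w ≤ b` onto the sector.
  have hstrip := PhragmenLindelof.horizontal_strip (a := a) (b := b) (C := B)
    (f := fun w => G (exp w)) (z := Real.log s + θ * I)
    (hG.comp differentiable_exp).diffContOnCl
    ⟨2, by rw [lt_div_iff₀ (by linarith)]; linarith, 2 * |A|,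
      .of_bound 1 (.of_forall fun w => ?_)⟩
    (fun w hw => by rw [hexp w, hw]; exact ha _ (Real.exp_pos _).le)
    (fun w hw => by rw [hexp w, hw]; exact hb _ (Real.exp_pos _).le)
    (by simpa using hθ.1) (by simpa using hθ.2)
  · rwa [exp_add, ← ofReal_exp, Real.exp_log hs] at hstrip
  · rw [one_mul, Real.norm_of_nonneg (Real.exp_pos _).le]
    refine (hA _).trans (Real.exp_le_exp.2 ?_)
    have hsq : ‖exp w‖ ^ 2 ≤ Real.exp (2 * |w.re|) := by
      rw [norm_exp, ← Real.exp_nat_mul]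
      have := le_abs_self w.re
      push_cast
      gcongr
    calc A * (1 + ‖exp w‖ ^ 2) ≤ |A| * (Real.exp (2 * |w.re|) + Real.exp (2 * |w.re|)) := by
          gcongr
          exacts [le_abs_self A, Real.one_le_exp (by positivity)]
      _ = 2 * |A| * Real.exp (2 * |w.re|) := by ring

/-- The hypotheses of Hörmander's vanishing argument: an entire function `h` of order two,
bounded by an increasing function `M` of the distance to the real line, whose restriction to the
real line has finite integral against `M`. Keeping the bound `B` of that integral as a parameter
allows `h` and its reflection `z ↦ h (-z)` to be treated together. -/
structure HasIntegrableMajorant (h : ℂ → ℂ) (M : ℝ → ℝ) (B : ℝ) : Prop where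
  differentiable : Differentiable ℂ h
  growth : HasOrderTwoGrowth h
  monotoneOn : MonotoneOn M (Ici 0)
  norm_le : ∀ z, ‖h z‖ ≤ M |z.im|
  integrable : Integrable fun s : ℝ => ‖h s‖ * M |s|
  integral_le : ∫ s : ℝ, ‖h s‖ * M |s| ≤ B

namespace HasIntegrableMajorant

variable {h h₁ h₂ : ℂ → ℂ} {M : ℝ → ℝ} {B : ℝ}

theorem comp_neg (hh : HasIntegrableMajorant h M B) :
    HasIntegrableMajorant (fun z => h (-z)) M B where
  differentiable := hh.differentiable.comp differentiable_neg
  growth := by simpa using hh.growth.comp_const_mul (-1)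
  monotoneOn := hh.monotoneOn
  norm_le z := by simpa using hh.norm_le (-z)
  integrable := by simpa using hh.integrable.comp_neg
  integral_le := by
    have := integral_neg_eq_self (fun s : ℝ => ‖h s‖ * M |s|) volume
    simp only [ofReal_neg, abs_neg] at this
    exact this.trans_le hh.integral_le

theorem majorant_abs_nonneg (hh : HasIntegrableMajorant h M B) (s : ℝ) : 0 ≤ M |s| := by
  simpa using (norm_nonneg _).trans (hh.norm_le (s * I))

theorem norm_le_majorant_norm (hh : HasIntegrableMajorant h M B) (z : ℂ) : ‖h z‖ ≤ M ‖z‖ :=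
  (hh.norm_le z).trans <|
    hh.monotoneOn (mem_Ici.2 (abs_nonneg _)) (mem_Ici.2 (norm_nonneg _)) (abs_im_le_norm z)

theorem norm_segmentIntegral_ray_le (hh₁ : HasIntegrableMajorant h₁ M B)
    (hh₂ : HasIntegrableMajorant h₂ M B) {c e : ℂ} (hc : ‖c‖ = 1) (he : ‖e‖ = 1)
    {s : ℝ} (hs : 0 ≤ s) :
    ‖segmentIntegral (fun u => h₁ (e⁻¹ * u) * h₂ (c * u)) (s * e)‖ ≤ B := by
  have he₀ : e ≠ 0 := norm_ne_zero_iff.1 (he ▸ one_ne_zero)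
  refine (norm_segmentIntegral_le_integral hh₁.integrable (fun u => ?_) he (fun u _ => ?_) hs).trans
    hh₁.integral_le
  · exact mul_nonneg (norm_nonneg _) (hh₁.majorant_abs_nonneg u)
  · have harg : e⁻¹ * (u * e) = u := by field_simp
    rw [norm_mul, harg]
    gcongr
    simpa [hc, he] using hh₂.norm_le_majorant_norm (c * (u * e))

/-- Rotating the argument of `h₁` by `-a` shrinks the quadrant to the sector
`a ≤ arg z ≤ π / 2`, in which functions of order two obey the Phragmén–Lindelöf principle. -/
theorem norm_segmentIntegral_sector_le (hh₁ : HasIntegrableMajorant h₁ M B)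
    (hh₂ : HasIntegrableMajorant h₂ M B) {a θ : ℝ} (ha : 0 < a) (hθ : θ ∈ Icc a (Real.pi / 2))
    {s : ℝ} (hs : 0 ≤ s) :
    ‖segmentIntegral (fun u => h₁ ((exp (a * I))⁻¹ * u) * h₂ (I * u)) (s * exp (θ * I))‖ ≤ B := by
  have hd₁ := hh₁.differentiable
  have hd₂ := hh₂.differentiable
  refine norm_le_of_norm_le_on_sector_boundary
    (differentiable_segmentIntegral (by fun_prop))
    ((hh₁.growth.comp_const_mul _).mul (hh₂.growth.comp_const_mul I)).segmentIntegral
    (by linarith)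
    (fun s hs => hh₁.norm_segmentIntegral_ray_le hh₂ norm_I (norm_exp_ofReal_mul_I a) hs)
    (fun s hs => ?_) hθ hs
  have hI : exp ((Real.pi / 2 : ℝ) * I) = I := by
    rw [ofReal_div, ofReal_ofNat, exp_pi_div_two_mul_I]
  have hray := hh₂.comp_neg.norm_segmentIntegral_ray_le hh₁ (c := (exp (a * I))⁻¹)
    (by rw [norm_inv, norm_exp_ofReal_mul_I, inv_one]) norm_I hs
  simpa only [hI, inv_I, neg_mul, neg_neg, mul_comm (h₂ _)] using hray

theorem norm_segmentIntegral_quadrant_le (hh₁ : HasIntegrableMajorant h₁ M B)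
    (hh₂ : HasIntegrableMajorant h₂ M B) {z : ℂ} (hre : 0 ≤ z.re) (him : 0 ≤ z.im) :
    ‖segmentIntegral (fun u => h₁ u * h₂ (I * u)) z‖ ≤ B := by
  have hpolar : z = ‖z‖ * exp (z.arg * I) := (norm_mul_exp_arg_mul_I z).symm
  obtain harg | harg := (arg_nonneg_iff.2 him).eq_or_lt
  · rw [hpolar, ← harg]
    simpa using hh₁.norm_segmentIntegral_ray_le hh₂ norm_I norm_one (norm_nonneg z)
  have hsector : ∀ a ∈ Ioo 0 z.arg,
      ‖segmentIntegral (fun u => h₁ ((exp (a * I))⁻¹ * u) * h₂ (I * u)) z‖ ≤ B := by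
    intro a ha
    rw [hpolar]
    exact hh₁.norm_segmentIntegral_sector_le hh₂ ha.1
      ⟨ha.2.le, arg_le_pi_div_two_iff.2 (.inl hre)⟩ (norm_nonneg z)
  have hcont : Continuous fun a : ℝ =>
      segmentIntegral (fun u => h₁ ((exp (a * I))⁻¹ * u) * h₂ (I * u)) z := by
    have := hh₁.differentiable.continuous
    have := hh₂.differentiable.continuous
    simp only [segmentIntegral, ← exp_neg]
    apply intervalIntegral.continuous_parametric_intervalIntegral_of_continuous'
    fun_prop
  have hlim := (hcont.norm.tendsto 0).mono_left (nhdsWithin_le_nhds (s := Ioi 0))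
  simpa using le_of_tendsto hlim (Filter.eventually_of_mem (Ioo_mem_nhdsGT harg) hsector)

theorem norm_segmentIntegral_le (hh : HasIntegrableMajorant h M B) (z : ℂ) :
    ‖segmentIntegral (fun u => h u * h (I * u)) z‖ ≤ B := by
  have hrot (c w : ℂ) (hc : ‖c‖ = 1) (hz : z = c * w) :
      ‖segmentIntegral (fun u => h u * h (I * u)) z‖ =
        ‖segmentIntegral (fun u => h (c * u) * h (I * (c * u))) w‖ := by
    rw [hz, segmentIntegral_const_mul, norm_mul, hc, one_mul]
  have hII (u : ℂ) : I * (I * u) = -u := by rw [← mul_assoc, I_mul_I, neg_one_mul]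
  rcases le_total 0 z.re with hre | hre <;> rcases le_total 0 z.im with him | him
  · exact hh.norm_segmentIntegral_quadrant_le hh hre him
  · rw [hrot (-I) (I * z) (by simp) (by simp [hII])]
    simpa [hII, mul_comm (h (-_))] using
      hh.norm_segmentIntegral_quadrant_le hh.comp_neg (z := I * z) (by simpa) (by simpa)
  · rw [hrot I (-(I * z)) (by simp) (by simp [hII])]
    simpa [hII, mul_comm (h (-_))] using
      hh.comp_neg.norm_segmentIntegral_quadrant_le hh (z := -(I * z)) (by simpa) (by simpa)
  · rw [hrot (-1) (-z) (by simp) (by simp)]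
    simpa using
      hh.comp_neg.norm_segmentIntegral_quadrant_le hh.comp_neg (z := -z) (by simpa) (by simpa)

theorem eq_zero (hh : HasIntegrableMajorant h M B) (z : ℂ) : h z = 0 := by
  have hd := hh.differentiable
  have hdI : Differentiable ℂ fun z => h (I * z) := by fun_prop
  obtain ⟨c, hc⟩ := (differentiable_segmentIntegral (hd.mul hdI)).exists_const_forall_eq_of_bounded
    (isBounded_iff_forall_norm_le.2 ⟨B, forall_mem_range.2 hh.norm_segmentIntegral_le⟩)
  have hprod (z : ℂ) : h z * h (I * z) = 0 := by
    have hderiv := hasDerivAt_segmentIntegral (hd.mul hdI) z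
    rw [funext hc] at hderiv
    exact hderiv.unique (hasDerivAt_const z c)
  rcases AnalyticOnNhd.eq_zero_or_eq_zero_of_mul_eq_zero (U := univ)
    (hd.differentiableOn.analyticOnNhd isOpen_univ)
    (hdI.differentiableOn.analyticOnNhd isOpen_univ) (fun z _ => hprod z)
    isPreconnected_univ with h₀ | h₀
  · exact h₀ z (mem_univ z)
  · simpa [← mul_assoc] using h₀ (-I * z) (mem_univ _)

end HasIntegrableMajorant

end EntireFunctions

section PhaseIntegrals

open Complex

variable {X F : Type*} [MeasurableSpace X] [NormedAddCommGroup F] {μ : Measure X} {l : X → ℝ}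
  {f g : X → F}

/-- The exponential moment `∫ ‖f(x)‖ e^|l(x)| dμ(x)` of the density `‖f‖`, possibly infinite. -/
noncomputable def expMoment (μ : Measure X) (l : X → ℝ) (f : X → F) : ENNReal :=
  ∫⁻ x, ‖f x‖ₑ * ENNReal.ofReal (Real.exp |l x|) ∂μ

theorem expMoment_congr_ae (hfg : f =ᵐ[μ] g) : expMoment μ l f = expMoment μ l g :=
  lintegral_congr_ae (hfg.mono fun x hx => by simp only [hx])

theorem expMoment_mono {l₁ l₂ : X → ℝ} (h : ∀ x, |l₁ x| ≤ |l₂ x|) :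
    expMoment μ l₁ f ≤ expMoment μ l₂ f :=
  lintegral_mono fun x => by
    have := h x
    gcongr ‖f x‖ₑ * ENNReal.ofReal (Real.exp ?_)

variable [NormedSpace ℂ F]

/-- The Fourier-type integral `∫ e^(-i l(x)) f(x) dμ(x)`. The Fourier transform at `ξ` is the case
`l x = ⟪x, ξ⟫`. -/
noncomputable def phaseIntegral (μ : Measure X) (l : X → ℝ) (f : X → F) : F :=
  ∫ x, exp (-(I * l x)) • f x ∂μ

theorem norm_exp_neg_I_mul_ofReal (r : ℝ) : ‖exp (-(I * r))‖ = 1 := by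
  simpa using norm_exp_I_mul_ofReal (-r)

theorem norm_phaseIntegral_le : ‖phaseIntegral μ l f‖ ≤ ∫ x, ‖f x‖ ∂μ := by
  simpa only [phaseIntegral, norm_smul, norm_exp_neg_I_mul_ofReal, one_mul] using
    norm_integral_le_integral_norm (μ := μ) fun x => exp (-(I * l x)) • f x

theorem phaseIntegral_congr_ae (hfg : f =ᵐ[μ] g) : phaseIntegral μ l f = phaseIntegral μ l g :=
  integral_congr_ae (hfg.mono fun x hx => by simp only [hx])

theorem integrable_phase_smul (hl : Measurable l) (hf : Integrable f μ) :
    Integrable (fun x => exp (-(I * l x)) • f x) μ :=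
  hf.bdd_smul 1 (Measurable.aestronglyMeasurable (by fun_prop))
    (.of_forall fun x => (norm_exp_neg_I_mul_ofReal (l x)).le)

theorem continuous_phaseIntegral {Y : Type*} [TopologicalSpace Y] [FirstCountableTopology Y]
    {L : Y → X → ℝ} (hL : ∀ y, Measurable (L y)) (hLc : ∀ x, Continuous fun y => L y x)
    (hf : Integrable f μ) : Continuous fun y => phaseIntegral μ (L y) f := by
  refine continuous_of_dominated (bound := fun x => ‖f x‖)
    (fun y => (integrable_phase_smul (hL y) hf).1) (fun y => .of_forall fun x => ?_) hf.norm
    (.of_forall fun x => ?_)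
  · rw [norm_smul, norm_exp_neg_I_mul_ofReal, one_mul]
  · have := hLc x
    fun_prop

theorem phaseIntegral_clm_comp {F' : Type*} [NormedAddCommGroup F'] [NormedSpace ℂ F']
    [CompleteSpace F] [CompleteSpace F'] (T : F →L[ℂ] F') (hl : Measurable l)
    (hf : Integrable f μ) :
    phaseIntegral μ l (fun x => T (f x)) = T (phaseIntegral μ l f) := by
  simpa only [phaseIntegral, map_smul] using T.integral_comp_comm (integrable_phase_smul hl hf)

section FourierUniqueness

variable {E : Type*} [NormedAddCommGroup E] [InnerProductSpace ℝ E] [FiniteDimensional ℝ E]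
  [MeasurableSpace E] [BorelSpace E] [CompleteSpace F] {f : E → F}

open FourierTransform SchwartzMap in
theorem ae_eq_zero_of_fourier_eq_zero (hf : Integrable f) (h : ∀ ξ, 𝓕 f ξ = 0) :
    f =ᵐ[volume] 0 := by
  refine ae_eq_zero_of_integral_contDiff_smul_eq_zero hf.locallyIntegrable fun g hg hgs => ?_
  let S : 𝓢(E, ℂ) := HasCompactSupport.toSchwartzMap (f := fun x => (g x : ℂ))
    (hgs.comp_left ofReal_zero) (ofRealCLM.contDiff.comp hg)
  have hS (x : E) : S x = g x := rfl
  have hflip : ∫ x, 𝓕 (𝓕⁻ S : 𝓢(E, ℂ)) x • f x = ∫ ξ, (𝓕⁻ S : 𝓢(E, ℂ)) ξ • 𝓕 f ξ := by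
    rw [SchwartzMap.fourier_coe]
    exact VectorFourier.integral_fourierIntegral_smul_eq_flip
      (L := innerₗ E) Real.continuous_fourierChar continuous_inner
      (𝓕⁻ S : 𝓢(E, ℂ)).integrable hf |>.trans
      (by rw [flip_innerₗ]; rfl)
  simpa [fourier_fourierInv_eq, h, hS] using hflip

theorem ae_eq_zero_of_phaseIntegral_inner_eq_zero (hf : Integrable f)
    (h : ∀ ξ, phaseIntegral volume (fun x => inner ℝ x ξ) f = 0) : f =ᵐ[volume] 0 := by
  refine ae_eq_zero_of_fourier_eq_zero hf fun ξ => ?_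
  rw [Real.fourier_eq', ← h ((2 * Real.pi) • ξ), phaseIntegral]
  congr! 4 with x
  rw [inner_smul_right]
  push_cast
  ring

end FourierUniqueness

end PhaseIntegrals

section GaussianLaplace

open Complex ProbabilityTheory

theorem integrable_exp_mul_abs_gaussianReal (a : ℝ) (v : NNReal) (t : ℝ) :
    Integrable (fun s => Real.exp (t * |s|)) (gaussianReal a v) :=
  integrable_exp_mul_abs (integrable_exp_mul_gaussianReal t) (integrable_exp_mul_gaussianReal (-t))

theorem integral_exp_mul_abs_gaussianReal_le (a : ℝ) (v : NNReal) (t : ℝ) :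
    ∫ s, Real.exp (t * |s|) ∂gaussianReal a v ≤ 2 * Real.exp (|t * a| + v * t ^ 2 / 2) := by
  have hmgf (t : ℝ) : ∫ s, Real.exp (t * s) ∂gaussianReal a v = Real.exp (a * t + v * t ^ 2 / 2) :=
    congrFun mgf_fun_id_gaussianReal t
  calc ∫ s, Real.exp (t * |s|) ∂gaussianReal a v
      ≤ ∫ s, (Real.exp (t * s) + Real.exp (-t * s)) ∂gaussianReal a v := by
        refine integral_mono (integrable_exp_mul_abs_gaussianReal a v t)
          ((integrable_exp_mul_gaussianReal t).add (integrable_exp_mul_gaussianReal (-t)))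
          fun s => ?_
        rcases abs_choice s with hs | hs <;> simp only [hs, mul_neg, neg_mul] <;>
          linarith [Real.exp_pos (t * s), Real.exp_pos (-(t * s))]
    _ = Real.exp (t * a + v * t ^ 2 / 2) + Real.exp (-(t * a) + v * t ^ 2 / 2) := by
        rw [integral_add (integrable_exp_mul_gaussianReal t) (integrable_exp_mul_gaussianReal (-t)),
          hmgf, hmgf]
        ring_nf
    _ ≤ 2 * Real.exp (|t * a| + v * t ^ 2 / 2) := by
        rw [two_mul]
        gcongr
        exacts [le_abs_self _, neg_le_abs _]

/-- The function `z ↦ ∫ e^(izr) φ(r) dγ(r)`, with `γ` the standard Gaussian measure; it is the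
entire extension of the Fourier transform of `φ γ`. -/
noncomputable def gaussianLaplace (φ : ℝ → ℂ) (z : ℂ) : ℂ :=
  ∫ r, exp (I * z * r) * φ r ∂gaussianReal 0 1

/-- The increasing function `t ↦ ∫ ‖φ(r)‖ e^(t|r|) dγ(r)`, which bounds `gaussianLaplace φ` in
terms of the distance `t` to the real line. -/
noncomputable def gaussianMajorant (φ : ℝ → ℂ) (t : ℝ) : ℝ :=
  ∫ r, ‖φ r‖ * Real.exp (t * |r|) ∂gaussianReal 0 1

variable {φ : ℝ → ℂ} {K : ℝ}

theorem norm_exp_I_mul_le (z : ℂ) (r : ℝ) : ‖exp (I * z * r)‖ ≤ Real.exp (|z.im| * |r|) := by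
  rw [norm_exp, Real.exp_le_exp, ← abs_mul]
  simpa [mul_assoc] using neg_le_abs (z.im * r)

theorem integrable_norm_mul_exp_mul_abs (hφ : Measurable φ) (hK : ∀ r, ‖φ r‖ ≤ K) (t : ℝ) :
    Integrable (fun r => ‖φ r‖ * Real.exp (t * |r|)) (gaussianReal 0 1) :=
  (integrable_exp_mul_abs_gaussianReal 0 1 t).bdd_mul (c := K) (by fun_prop)
    (.of_forall fun r => by simpa using hK r)

theorem norm_gaussianLaplace_le (hφ : Measurable φ) (hK : ∀ r, ‖φ r‖ ≤ K) (z : ℂ) :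
    ‖gaussianLaplace φ z‖ ≤ gaussianMajorant φ |z.im| := by
  refine norm_integral_le_of_norm_le (integrable_norm_mul_exp_mul_abs hφ hK _)
    (.of_forall fun r => ?_)
  rw [norm_mul, mul_comm]
  gcongr
  exact norm_exp_I_mul_le z r

theorem monotone_gaussianMajorant (hφ : Measurable φ) (hK : ∀ r, ‖φ r‖ ≤ K) :
    Monotone (gaussianMajorant φ) := fun s t hst =>
  integral_mono (integrable_norm_mul_exp_mul_abs hφ hK s) (integrable_norm_mul_exp_mul_abs hφ hK t)
    fun r => by beta_reduce; gcongr

theorem gaussianMajorant_le (hφ : Measurable φ) (hK : ∀ r, ‖φ r‖ ≤ K) (t : ℝ) :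
    gaussianMajorant φ t ≤ K * (2 * Real.exp (t ^ 2 / 2)) := by
  have hK₀ : 0 ≤ K := (norm_nonneg _).trans (hK 0)
  calc gaussianMajorant φ t ≤ ∫ r, K * Real.exp (t * |r|) ∂gaussianReal 0 1 :=
        integral_mono (integrable_norm_mul_exp_mul_abs hφ hK t)
          ((integrable_exp_mul_abs_gaussianReal 0 1 t).const_mul K) fun r => by
            beta_reduce
            gcongr
            exact hK r
    _ ≤ K * (2 * Real.exp (t ^ 2 / 2)) := by
        rw [integral_const_mul]
        gcongr
        simpa using integral_exp_mul_abs_gaussianReal_le 0 1 t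

theorem hasOrderTwoGrowth_gaussianLaplace (hφ : Measurable φ) (hK : ∀ r, ‖φ r‖ ≤ K) :
    HasOrderTwoGrowth (gaussianLaplace φ) := by
  have hK₀ : 0 ≤ K := (norm_nonneg _).trans (hK 0)
  refine ⟨2 * K + 1, fun z => ?_⟩
  have him : |z.im| ^ 2 ≤ ‖z‖ ^ 2 := by
    gcongr
    exact abs_im_le_norm z
  calc ‖gaussianLaplace φ z‖ ≤ K * (2 * Real.exp (|z.im| ^ 2 / 2)) :=
        (norm_gaussianLaplace_le hφ hK z).trans (gaussianMajorant_le hφ hK _)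
    _ ≤ Real.exp (2 * K) * Real.exp (|z.im| ^ 2 / 2) := by
        rw [← mul_assoc]
        gcongr
        linarith [Real.add_one_le_exp (2 * K)]
    _ ≤ Real.exp ((2 * K + 1) * (1 + ‖z‖ ^ 2)) := by
        rw [← Real.exp_add]
        gcongr
        nlinarith [mul_nonneg hK₀ (sq_nonneg ‖z‖), sq_nonneg ‖z‖]

theorem differentiable_gaussianLaplace (hφ : Measurable φ) (hK : ∀ r, ‖φ r‖ ≤ K) :
    Differentiable ℂ (gaussianLaplace φ) := by
  intro z₀
  have hderiv (z : ℂ) (r : ℝ) :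
      HasDerivAt (fun z => exp (I * z * r) * φ r) (exp (I * z * r) * (I * r) * φ r) z := by
    have hlin : HasDerivAt (fun z : ℂ => I * z * r) (I * r) z := by
      simpa using ((hasDerivAt_id z).const_mul I).mul_const (r : ℂ)
    exact hlin.cexp.mul_const _
  have hint : Integrable (fun r : ℝ => exp (I * z₀ * r) * φ r) (gaussianReal 0 1) := by
    refine (integrable_norm_mul_exp_mul_abs hφ hK |z₀.im|).mono'
      (Measurable.aestronglyMeasurable (by fun_prop)) (.of_forall fun r => ?_)
    rw [norm_mul, mul_comm]
    gcongr
    exact norm_exp_I_mul_le z₀ r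
  refine (hasDerivAt_integral_of_dominated_loc_of_deriv_le (Metric.ball_mem_nhds z₀ one_pos)
    (F' := fun z r => exp (I * z * r) * (I * r) * φ r)
    (bound := fun r => ‖φ r‖ * Real.exp ((|z₀.im| + 2) * |r|))
    (.of_forall fun z => Measurable.aestronglyMeasurable (by fun_prop)) hint
    (Measurable.aestronglyMeasurable (by fun_prop)) (.of_forall fun r z hz => ?_)
    (integrable_norm_mul_exp_mul_abs hφ hK _)
    (.of_forall fun r z _ => hderiv z r)).2.differentiableAt
  have him : |z.im| ≤ |z₀.im| + 1 := by
    have hsub : |(z - z₀).im| ≤ 1 :=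
      (abs_im_le_norm _).trans (by simpa [dist_eq] using (Metric.mem_ball.1 hz).le)
    rw [sub_im] at hsub
    linarith [abs_sub_abs_le_abs_sub z.im z₀.im]
  calc ‖exp (I * z * r) * (I * r) * φ r‖ = ‖φ r‖ * (‖exp (I * z * r)‖ * |r|) := by
        simp only [norm_mul, norm_I, norm_real, Real.norm_eq_abs]
        ring
    _ ≤ ‖φ r‖ * (Real.exp ((|z₀.im| + 1) * |r|) * Real.exp |r|) := by
        gcongr
        · exact (norm_exp_I_mul_le z r).trans (Real.exp_le_exp.2 (by gcongr))
        · linarith [Real.add_one_le_exp |r|]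
    _ = ‖φ r‖ * Real.exp ((|z₀.im| + 2) * |r|) := by
        rw [← Real.exp_add]
        ring_nf

end GaussianLaplace

section UncertaintyAlongFunction

open Complex ProbabilityTheory ENNReal

variable {φ : ℝ → ℂ} {K : ℝ}

theorem enorm_gaussianMajorant (hφ : Measurable φ) (hK : ∀ r, ‖φ r‖ ≤ K) (t : ℝ) :
    ‖gaussianMajorant φ t‖ₑ =
      ∫⁻ r, ‖φ r‖ₑ * ENNReal.ofReal (Real.exp (t * |r|)) ∂gaussianReal 0 1 := by
  have hnonneg (r : ℝ) : 0 ≤ ‖φ r‖ * Real.exp (t * |r|) := by positivity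
  rw [gaussianMajorant, Real.enorm_of_nonneg (integral_nonneg hnonneg),
    ofReal_integral_eq_lintegral_ofReal (integrable_norm_mul_exp_mul_abs hφ hK t)
      (.of_forall hnonneg)]
  simp only [ENNReal.ofReal_mul (norm_nonneg _), ofReal_norm]

theorem lintegral_gaussianReal_eq_lintegral_mul (a : ℝ) {v : NNReal} (hv : v ≠ 0) {g : ℝ → ℝ≥0∞}
    (hg : Measurable g) : ∫⁻ s, g s ∂gaussianReal a v = ∫⁻ s, gaussianPDF a v s * g s := by
  rw [gaussianReal_of_var_ne_zero a hv]
  exact lintegral_withDensity_eq_lintegral_mul _ (measurable_gaussianPDF a v) hg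

@[fun_prop]
theorem measurable_gaussianPDF_comp {Y : Type*} [MeasurableSpace Y] {a s : Y → ℝ} (v : NNReal)
    (ha : Measurable a) (hs : Measurable s) : Measurable fun y => gaussianPDF (a y) v (s y) :=
  measurable_uncurry_gaussianPDF.comp (ha.prodMk (measurable_const.prodMk hs))

theorem gaussianPDFReal_one (a s : ℝ) :
    gaussianPDFReal a 1 s = (√(2 * Real.pi))⁻¹ * Real.exp (-(s - a) ^ 2 / 2) := by
  simp [gaussianPDFReal_def]

theorem eq_zero_of_gaussianLaplace_ofReal_eq_zero (hφ : Continuous φ) (hK : ∀ r, ‖φ r‖ ≤ K)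
    (h : ∀ s : ℝ, gaussianLaplace φ s = 0) (r : ℝ) : φ r = 0 := by
  have hint : Integrable fun r => gaussianPDFReal 0 1 r • φ r :=
    (integrable_gaussianPDFReal 0 1).smul_bdd K hφ.aestronglyMeasurable (.of_forall hK)
  have hae : (fun r => gaussianPDFReal 0 1 r • φ r) =ᵐ[volume] 0 := by
    refine ae_eq_zero_of_phaseIntegral_inner_eq_zero hint fun ξ => ?_
    rw [← h (-ξ), gaussianLaplace, integral_gaussianReal_eq_integral_smul one_ne_zero,
      phaseIntegral]
    congr! 2 with r
    rw [smul_comm, smul_eq_mul (exp _)]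
    simp [mul_assoc]
  have hcont : Continuous fun r => gaussianPDFReal 0 1 r • φ r := by
    simp only [gaussianPDFReal_one]
    fun_prop
  have hzero := congrFun ((hcont.ae_eq_iff_eq volume continuous_zero).1 hae) r
  exact (smul_eq_zero.1 hzero).resolve_left (gaussianPDFReal_pos 0 1 r one_ne_zero).ne'

variable {X : Type*} [MeasurableSpace X] {μ : Measure X} {f : X → ℂ} {l : X → ℝ}

theorem gaussianLaplace_phaseIntegral [SFinite μ] (hl : Measurable l) (hf : Integrable f μ)
    (s : ℝ) :
    gaussianLaplace (fun r => phaseIntegral μ (r • l) f) s =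
      ∫ x, exp (-(s - l x) ^ 2 / 2) * f x ∂μ := by
  have hphase (r : ℝ) (x : X) : exp (I * s * r) * (exp (-(I * (r • l) x)) * f x) =
      exp (-(I * (r * (l x - s) : ℝ))) * f x := by
    rw [← mul_assoc, ← exp_add, Pi.smul_apply, smul_eq_mul]
    push_cast
    ring_nf
  have hint : Integrable (fun p : ℝ × X => exp (-(I * (p.1 * (l p.2 - s) : ℝ))) * f p.2)
      ((gaussianReal 0 1).prod μ) :=
    integrable_phase_smul (by fun_prop) (hf.comp_snd _)
  have hchar (a : ℝ) :
      ∫ r, exp (-(I * (r * (a - s) : ℝ))) ∂gaussianReal 0 1 = exp (-(s - a) ^ 2 / 2) := by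
    have := charFun_gaussianReal (μ := 0) (v := 1) (s - a)
    rw [charFun_apply_real] at this
    convert this using 3 <;> push_cast <;> ring_nf
  simp only [gaussianLaplace, phaseIntegral, smul_eq_mul, ← integral_const_mul, hphase]
  rw [integral_integral_swap hint]
  simp only [integral_mul_const, hchar]

theorem enorm_gaussianLaplace_phaseIntegral_le [SFinite μ] (hl : Measurable l)
    (hf : Integrable f μ) (s : ℝ) :
    ‖gaussianLaplace (fun r => phaseIntegral μ (r • l) f) s‖ₑ ≤
      ENNReal.ofReal √(2 * Real.pi) * ∫⁻ x, ‖f x‖ₑ * gaussianPDF (l x) 1 s ∂μ := by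
  rw [gaussianLaplace_phaseIntegral hl hf, ← lintegral_const_mul' _ _ ofReal_ne_top]
  refine (enorm_integral_le_lintegral_enorm _).trans_eq (lintegral_congr fun x => ?_)
  have hnorm : ‖exp (-(s - l x) ^ 2 / 2)‖ = √(2 * Real.pi) * gaussianPDFReal (l x) 1 s := by
    rw [gaussianPDFReal_one, mul_inv_cancel_left₀ (by positivity), norm_exp]
    norm_cast
  rw [enorm_mul, ← ofReal_norm (exp _), hnorm, ENNReal.ofReal_mul (by positivity),
    gaussianPDF]
  ring

theorem lintegral_gaussianPDF_mul_exp_le (a t : ℝ) :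
    ∫⁻ s, gaussianPDF a 1 s * ENNReal.ofReal (Real.exp (t * |s|)) ≤
      ENNReal.ofReal (2 * Real.exp (|t * a| + t ^ 2 / 2)) := by
  rw [← lintegral_gaussianReal_eq_lintegral_mul a one_ne_zero (by fun_prop),
    ← ofReal_integral_eq_lintegral_ofReal (integrable_exp_mul_abs_gaussianReal a 1 t)
      (.of_forall fun s => (Real.exp_pos _).le)]
  gcongr
  simpa using integral_exp_mul_abs_gaussianReal_le a 1 t

theorem gaussianPDF_mul_exp (r b : ℝ) :
    gaussianPDF 0 1 r * ENNReal.ofReal (2 * Real.exp (b + r ^ 2 / 2)) =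
      ENNReal.ofReal (2 * (√(2 * Real.pi))⁻¹) * ENNReal.ofReal (Real.exp b) := by
  rw [gaussianPDF, gaussianPDFReal_one, ← ENNReal.ofReal_mul (by positivity),
    ← ENNReal.ofReal_mul (by positivity), sub_zero, mul_mul_mul_comm, ← Real.exp_add]
  congr 1
  ring_nf

theorem lintegral_lintegral_lintegral_rotate {α β δ : Type*} [MeasurableSpace α]
    [MeasurableSpace β] [MeasurableSpace δ] {μ : Measure α} {ν : Measure β} {ρ : Measure δ}
    [SFinite μ] [SFinite ν] [SFinite ρ] {k : α → β → δ → ℝ≥0∞}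
    (hk : Measurable fun p : (α × β) × δ => k p.1.1 p.1.2 p.2) :
    ∫⁻ a, ∫⁻ b, ∫⁻ c, k a b c ∂ρ ∂ν ∂μ = ∫⁻ b, ∫⁻ c, (∫⁻ a, k a b c ∂μ) ∂ρ ∂ν := by
  rw [lintegral_lintegral_swap hk.lintegral_prod_right'.aemeasurable]
  refine lintegral_congr fun b => lintegral_lintegral_swap ?_
  exact (hk.comp (f := fun p : α × δ => ((p.1, b), p.2)) (by fun_prop)).aemeasurable

theorem lintegral_gaussianReal_mul_lintegral_exp [SFinite μ] {G : X → ℝ≥0∞} {Φ : ℝ → ℝ≥0∞}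
    (hG : Measurable G) (hΦ : Measurable Φ) (hl : Measurable l) :
    ∫⁻ r, ∫⁻ x, Φ r * G x * ENNReal.ofReal (2 * Real.exp (|r * l x| + r ^ 2 / 2))
        ∂μ ∂gaussianReal 0 1 =
      ENNReal.ofReal (2 * (√(2 * Real.pi))⁻¹) *
        ∫⁻ r, Φ r * ∫⁻ x, G x * ENNReal.ofReal (Real.exp |r * l x|) ∂μ := by
  rw [lintegral_gaussianReal_eq_lintegral_mul 0 one_ne_zero
    (Measurable.lintegral_prod_right (by unfold Function.uncurry; fun_prop)),
    ← lintegral_const_mul' _ _ ofReal_ne_top]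
  refine lintegral_congr fun r => ?_
  rw [← lintegral_const_mul _ (by fun_prop), ← lintegral_const_mul _ (by fun_prop),
    ← lintegral_const_mul' _ _ ofReal_ne_top]
  refine lintegral_congr fun x => ?_
  rw [mul_left_comm, gaussianPDF_mul_exp]
  ring

/-- Integrating `e^|rs|` against the Gaussian centred at `l x` costs a factor `e^(r² / 2)`, which
the density of the Gaussian weight of `Φ` compensates. -/
theorem lintegral_gaussianPDF_mul_lintegral_gaussianReal_le [SFinite μ] {G : X → ℝ≥0∞}
    {Φ : ℝ → ℝ≥0∞} (hG : Measurable G) (hΦ : Measurable Φ) (hl : Measurable l) :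
    ∫⁻ s, (∫⁻ x, G x * gaussianPDF (l x) 1 s ∂μ) *
        (∫⁻ r, Φ r * ENNReal.ofReal (Real.exp (|s| * |r|)) ∂gaussianReal 0 1) ≤
      ENNReal.ofReal (2 * (√(2 * Real.pi))⁻¹) *
        ∫⁻ r, Φ r * ∫⁻ x, G x * ENNReal.ofReal (Real.exp |r * l x|) ∂μ := by
  calc _ = ∫⁻ s, ∫⁻ r, ∫⁻ x, Φ r * G x *
          (gaussianPDF (l x) 1 s * ENNReal.ofReal (Real.exp (|r| * |s|))) ∂μ ∂gaussianReal 0 1 := by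
        refine lintegral_congr fun s => ?_
        rw [mul_comm, ← lintegral_lintegral_mul (by fun_prop) (by fun_prop)]
        refine lintegral_congr fun r => lintegral_congr fun x => ?_
        rw [mul_comm |s|]
        ring
    _ = ∫⁻ r, ∫⁻ x, (∫⁻ s, Φ r * G x *
          (gaussianPDF (l x) 1 s * ENNReal.ofReal (Real.exp (|r| * |s|)))) ∂μ ∂gaussianReal 0 1 :=
        lintegral_lintegral_lintegral_rotate (by fun_prop)
    _ ≤ ∫⁻ r, ∫⁻ x, Φ r * G x * ENNReal.ofReal (2 * Real.exp (|r * l x| + r ^ 2 / 2))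
          ∂μ ∂gaussianReal 0 1 := by
        gcongr with r x
        rw [lintegral_const_mul _ (by fun_prop)]
        gcongr
        simpa [abs_mul] using lintegral_gaussianPDF_mul_exp_le (l x) |r|
    _ = _ := lintegral_gaussianReal_mul_lintegral_exp hG hΦ hl

theorem integrable_norm_gaussianLaplace_mul_gaussianMajorant [SFinite μ] (hl : Measurable l)
    (hf : Integrable f μ) (hfm : Measurable f) (hφ : φ = fun r => phaseIntegral μ (r • l) f)
    (hfin : ∫⁻ r : ℝ, ‖φ r‖ₑ * expMoment μ (r • l) f < ⊤) :
    Integrable fun s : ℝ => ‖gaussianLaplace φ s‖ * gaussianMajorant φ |s| := by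
  have hcont : Continuous φ := hφ ▸
    continuous_phaseIntegral (fun r => hl.const_smul r) (fun x => by fun_prop) hf
  have hK (r : ℝ) : ‖φ r‖ ≤ ∫ x, ‖f x‖ ∂μ := hφ ▸ norm_phaseIntegral_le
  have hmeas : Measurable fun s : ℝ => ‖gaussianLaplace φ s‖ * gaussianMajorant φ |s| :=
    ((differentiable_gaussianLaplace hcont.measurable hK).continuous.comp
      continuous_ofReal).measurable.norm.mul
      ((monotone_gaussianMajorant hcont.measurable hK).measurable.comp measurable_norm)
  refine ⟨hmeas.aestronglyMeasurable, ?_⟩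
  calc ∫⁻ s : ℝ, ‖‖gaussianLaplace φ s‖ * gaussianMajorant φ |s|‖ₑ
      ≤ ∫⁻ s : ℝ, ENNReal.ofReal √(2 * Real.pi) *
          ((∫⁻ x, ‖f x‖ₑ * gaussianPDF (l x) 1 s ∂μ) *
            ∫⁻ r, ‖φ r‖ₑ * ENNReal.ofReal (Real.exp (|s| * |r|)) ∂gaussianReal 0 1) := by
        gcongr with s
        rw [enorm_mul, enorm_norm, enorm_gaussianMajorant hcont.measurable hK, ← mul_assoc]
        gcongr
        exact hφ ▸ enorm_gaussianLaplace_phaseIntegral_le hl hf s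
    _ ≤ ENNReal.ofReal √(2 * Real.pi) * (ENNReal.ofReal (2 * (√(2 * Real.pi))⁻¹) *
          ∫⁻ r : ℝ, ‖φ r‖ₑ * expMoment μ (r • l) f) := by
        rw [lintegral_const_mul' _ _ ofReal_ne_top]
        gcongr
        exact lintegral_gaussianPDF_mul_lintegral_gaussianReal_le hfm.enorm
          hcont.measurable.enorm hl
    _ < ⊤ := mul_lt_top ofReal_lt_top (mul_lt_top ofReal_lt_top hfin)

theorem phaseIntegral_smul_eq_zero [SFinite μ] (hl : Measurable l) (hf : Integrable f μ)
    (hfm : Measurable f)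
    (hfin : ∫⁻ r : ℝ, ‖phaseIntegral μ (r • l) f‖ₑ * expMoment μ (r • l) f < ⊤) (r : ℝ) :
    phaseIntegral μ (r • l) f = 0 := by
  have hφ : Continuous fun r : ℝ => phaseIntegral μ (r • l) f :=
    continuous_phaseIntegral (fun r => hl.const_smul r) (fun x => by fun_prop) hf
  have hK (r : ℝ) : ‖phaseIntegral μ (r • l) f‖ ≤ ∫ x, ‖f x‖ ∂μ := norm_phaseIntegral_le
  refine eq_zero_of_gaussianLaplace_ofReal_eq_zero hφ hK (fun s => ?_) r
  exact HasIntegrableMajorant.eq_zero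
    { differentiable := differentiable_gaussianLaplace hφ.measurable hK
      growth := hasOrderTwoGrowth_gaussianLaplace hφ.measurable hK
      monotoneOn := (monotone_gaussianMajorant hφ.measurable hK).monotoneOn _
      norm_le := norm_gaussianLaplace_le hφ.measurable hK
      integrable := integrable_norm_gaussianLaplace_mul_gaussianMajorant hl hf hfm rfl hfin
      integral_le := le_rfl } s

end UncertaintyAlongFunction

section PolarCoordinates

open Module Metric Set

variable {E : Type*} [NormedAddCommGroup E] [NormedSpace ℝ E] [FiniteDimensional ℝ E]
  [Nontrivial E] [MeasurableSpace E] [BorelSpace E] {μ : Measure E} [μ.IsAddHaarMeasure]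
  {W : E → ENNReal}

theorem lintegral_eq_lintegral_toSphere (hW : Measurable W) :
    ∫⁻ v, W v ∂μ = ∫⁻ u, (∫⁻ r in Ioi (0 : ℝ),
      ENNReal.ofReal (r ^ (finrank ℝ E - 1)) * W (r • (u : E))) ∂μ.toSphere := by
  have hpolar : Measurable fun p : sphere (0 : E) 1 × Ioi (0 : ℝ) => W ((p.2 : ℝ) • (p.1 : E)) := by
    fun_prop
  calc ∫⁻ v, W v ∂μ
      = ∫⁻ v : ({0}ᶜ : Set E), W v ∂μ.comap (↑) := by
        rw [lintegral_subtype_comap (measurableSet_singleton _).compl,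
          restrict_compl_singleton]
    _ = ∫⁻ p, W ((p.2 : ℝ) • (p.1 : E))
          ∂μ.toSphere.prod (Measure.volumeIoiPow (finrank ℝ E - 1)) := by
        rw [← μ.measurePreserving_homeomorphUnitSphereProd.lintegral_comp hpolar]
        refine lintegral_congr fun v => ?_
        simp [smul_inv_smul₀ (norm_ne_zero_iff.2 v.2)]
    _ = _ := by
        rw [lintegral_prod _ hpolar.aemeasurable]
        refine lintegral_congr fun u => ?_
        rw [Measure.volumeIoiPow,
          lintegral_withDensity_eq_lintegral_mul _ (by fun_prop) (by fun_prop)]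
        exact lintegral_subtype_comap measurableSet_Ioi
          fun r => ENNReal.ofReal (r ^ (finrank ℝ E - 1)) * W (r • (u : E))

theorem ae_lintegral_Ioi_lt_top (hW : Measurable W) (hfin : ∫⁻ v, W v ∂μ < ⊤) :
    ∀ᵐ u : sphere (0 : E) 1 ∂μ.toSphere, ∫⁻ r in Ioi (0 : ℝ),
      ENNReal.ofReal (|r| ^ (finrank ℝ E - 1)) * W (r • (u : E)) < ⊤ := by
  rw [lintegral_eq_lintegral_toSphere hW] at hfin
  have hmeas : Measurable fun u : sphere (0 : E) 1 => ∫⁻ r in Ioi (0 : ℝ),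
      ENNReal.ofReal (r ^ (finrank ℝ E - 1)) * W (r • (u : E)) :=
    Measurable.lintegral_prod_right (by unfold Function.uncurry; fun_prop)
  filter_upwards [ae_lt_top hmeas hfin.ne] with u hu
  refine lt_of_eq_of_lt (setLIntegral_congr_fun measurableSet_Ioi fun r hr => ?_) hu
  simp only [abs_of_pos (mem_Ioi.1 hr)]

theorem lintegral_eq_lintegral_Ioi_add_lintegral_Ioi_neg (F : ℝ → ENNReal) :
    ∫⁻ r, F r = (∫⁻ r in Ioi 0, F r) + ∫⁻ r in Ioi 0, F (-r) := by
  have hneg := (Measure.measurePreserving_neg (volume : Measure ℝ)).setLIntegral_comp_preimage_emb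
    (MeasurableEquiv.neg ℝ).measurableEmbedding F (Iio 0)
  rw [← lintegral_add_compl F measurableSet_Ioi, compl_Ioi, setLIntegral_congr Iio_ae_eq_Iic.symm,
    ← hneg]
  simp

theorem ae_lintegral_line_lt_top (hW : Measurable W) (hfin : ∫⁻ v, W v ∂μ < ⊤) :
    ∀ᵐ u : sphere (0 : E) 1 ∂μ.toSphere,
      ∫⁻ r : ℝ, ENNReal.ofReal (|r| ^ (finrank ℝ E - 1)) * W (r • (u : E)) < ⊤ := by
  have hfin_neg : ∫⁻ v, W (-v) ∂μ < ⊤ := by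
    rwa [(Measure.measurePreserving_neg μ).lintegral_comp hW]
  filter_upwards [ae_lintegral_Ioi_lt_top hW hfin,
    ae_lintegral_Ioi_lt_top (hW.comp measurable_neg) hfin_neg] with u hpos hneg
  rw [lintegral_eq_lintegral_Ioi_add_lintegral_Ioi_neg]
  simpa only [abs_neg, neg_smul, Function.comp_apply] using ENNReal.add_lt_top.2 ⟨hpos, hneg⟩

theorem lintegral_lt_top_of_lintegral_abs_pow_mul_lt_top {F : ℝ → ENNReal} {K : ENNReal} {R : ℝ}
    (hR : 0 < R) (hK : K < ⊤) (hF : ∀ r, |r| ≤ R → F r ≤ K) (d : ℕ)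
    (hfin : ∫⁻ r, ENNReal.ofReal (|r| ^ d) * F r < ⊤) : ∫⁻ r, F r < ⊤ := by
  have hRd : 0 < ENNReal.ofReal (R ^ d) := ENNReal.ofReal_pos.2 (pow_pos hR d)
  rw [← lintegral_add_compl F (measurableSet_Icc (a := -R) (b := R))]
  refine ENNReal.add_lt_top.2 ⟨?_, ?_⟩
  · calc ∫⁻ r in Icc (-R) R, F r ≤ ∫⁻ _ in Icc (-R) R, K :=
          setLIntegral_mono' measurableSet_Icc fun r hr => hF r (abs_le.2 hr)
      _ = K * volume (Icc (-R) R) := setLIntegral_const _ _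
      _ < ⊤ := ENNReal.mul_lt_top hK measure_Icc_lt_top
  · calc ∫⁻ r in (Icc (-R) R)ᶜ, F r
        ≤ ∫⁻ r in (Icc (-R) R)ᶜ,
            (ENNReal.ofReal (R ^ d))⁻¹ * (ENNReal.ofReal (|r| ^ d) * F r) := by
          refine setLIntegral_mono' measurableSet_Icc.compl fun r hr => ?_
          have hRr : R ≤ |r| := le_of_not_ge fun h => hr (abs_le.1 h)
          calc F r = (ENNReal.ofReal (R ^ d))⁻¹ * (ENNReal.ofReal (R ^ d) * F r) := by
                rw [ENNReal.inv_mul_cancel_left hRd.ne' ENNReal.ofReal_ne_top]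
            _ ≤ _ := by gcongr
      _ ≤ ∫⁻ r, (ENNReal.ofReal (R ^ d))⁻¹ * (ENNReal.ofReal (|r| ^ d) * F r) :=
          setLIntegral_le_lintegral _ _
      _ < ⊤ := by
          rw [lintegral_const_mul' _ _ (ENNReal.inv_ne_top.2 hRd.ne')]
          exact ENNReal.mul_lt_top (ENNReal.inv_lt_top.2 hRd) hfin

end PolarCoordinates

section ScalarUncertainty

theorem measurable_expMoment {X Y F : Type*} [MeasurableSpace X] [MeasurableSpace Y]
    [NormedAddCommGroup F] {μ : Measure X} [SFinite μ] {L : Y → X → ℝ} {f : X → F}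
    (hL : Measurable (Function.uncurry L)) (hf : StronglyMeasurable f) :
    Measurable fun y => expMoment μ (L y) f := by
  have hexp : Measurable fun p : Y × X => ENNReal.ofReal (Real.exp |Function.uncurry L p|) := by
    fun_prop
  exact ((hf.enorm.comp measurable_snd).mul hexp).lintegral_prod_right'

/-- A power weight only degenerates at the origin, where both factors are bounded. -/
theorem phaseIntegral_smul_eq_zero_of_abs_pow_mul {X : Type*} [MeasurableSpace X] {μ : Measure X}
    [SFinite μ] {f : X → ℂ} {l : X → ℝ} (hl : Measurable l) (hf : Integrable f μ)
    (hfm : Measurable f) (d : ℕ)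
    (hfin : ∫⁻ r : ℝ, ENNReal.ofReal (|r| ^ d) *
      (‖phaseIntegral μ (r • l) f‖ₑ * expMoment μ (r • l) f) < ⊤) (r : ℝ) :
    phaseIntegral μ (r • l) f = 0 := by
  have hcont : Continuous fun r : ℝ => phaseIntegral μ (r • l) f :=
    continuous_phaseIntegral (fun r => hl.const_smul r) (fun x => by fun_prop) hf
  have hmoment : Measurable fun r : ℝ => expMoment μ (r • l) f :=
    measurable_expMoment (L := fun r : ℝ => r • l)
      (measurable_fst.mul (hl.comp measurable_snd)) hfm.stronglyMeasurable
  have hfin_ae := ae_lt_top (by have := hcont.measurable.enorm; fun_prop) hfin.ne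
  by_contra hr
  obtain ⟨r₀, ⟨hr₀fin, hr₀⟩, hφ₀⟩ := (Measure.dense_of_ae
    (hfin_ae.and (Measure.ae_ne volume (0 : ℝ)))).exists_mem_open
    (isOpen_ne_fun hcont continuous_const) ⟨r, hr⟩
  have hmoment₀ : expMoment μ (r₀ • l) f < ⊤ := by
    have hpow : ENNReal.ofReal (|r₀| ^ d) ≠ 0 := by positivity
    refine lt_top_iff_ne_top.2 fun htop => hr₀fin.ne ?_
    rw [htop, ENNReal.mul_top (enorm_ne_zero.2 hφ₀), ENNReal.mul_top hpow]
  have hbound (s : ℝ) (hs : |s| ≤ |r₀|) :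
      ‖phaseIntegral μ (s • l) f‖ₑ * expMoment μ (s • l) f ≤
        ENNReal.ofReal (∫ x, ‖f x‖ ∂μ) * expMoment μ (r₀ • l) f := by
    refine mul_le_mul' ?_ (expMoment_mono fun x => ?_)
    · exact (ofReal_norm _).symm.trans_le (ENNReal.ofReal_le_ofReal norm_phaseIntegral_le)
    · simp only [Pi.smul_apply, smul_eq_mul, abs_mul]
      gcongr
  exact hr (phaseIntegral_smul_eq_zero hl hf hfm
    (lintegral_lt_top_of_lintegral_abs_pow_mul_lt_top (abs_pos.2 hr₀)
      (ENNReal.mul_lt_top ENNReal.ofReal_lt_top hmoment₀) hbound d hfin) r)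

theorem phaseIntegral_inner_eq_zero {E : Type*} [NormedAddCommGroup E] [InnerProductSpace ℝ E]
    [FiniteDimensional ℝ E] [Nontrivial E] [MeasurableSpace E] [BorelSpace E] {f : E → ℂ}
    (hf : Integrable f) (hfm : Measurable f)
    (hfin : ∫⁻ ξ : E, ‖phaseIntegral volume (fun x => inner ℝ x ξ) f‖ₑ *
      expMoment volume (fun x => inner ℝ x ξ) f < ⊤) (ξ : E) :
    phaseIntegral volume (fun x => inner ℝ x ξ) f = 0 := by
  let g (ξ : E) : ℂ := phaseIntegral volume (fun x => inner ℝ x ξ) f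
  have hgc : Continuous g := continuous_phaseIntegral (by fun_prop) (by fun_prop) hf
  have hmoment : Measurable fun ξ : E => expMoment volume (fun x => inner ℝ x ξ) f :=
    measurable_expMoment (by unfold Function.uncurry; fun_prop) hfm.stronglyMeasurable
  have hline (r : ℝ) (v : E) :
      (fun x => inner ℝ x (r • v)) = r • fun x : E => (inner ℝ x v : ℝ) := by
    ext x
    simp [inner_smul_right]
  have hsphere_ae : ∀ᵐ u : Metric.sphere (0 : E) 1 ∂volume.toSphere,
      ∀ r : ℝ, g (r • (u : E)) = 0 := by
    filter_upwards [ae_lintegral_line_lt_top (hgc.measurable.enorm.mul hmoment) hfin] with u hu r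
    simp only [Pi.mul_apply, g, hline] at hu ⊢
    exact phaseIntegral_smul_eq_zero_of_abs_pow_mul (by fun_prop) hf hfm _ hu r
  have hsphere (r : ℝ) : (fun u : Metric.sphere (0 : E) 1 => g (r • (u : E))) = 0 :=
    (Continuous.ae_eq_iff_eq volume.toSphere (by fun_prop) continuous_zero).1
      (hsphere_ae.mono fun u hu => hu r)
  obtain ⟨u, hu⟩ : ∃ u : Metric.sphere (0 : E) 1, ‖ξ‖ • (u : E) = ξ := by
    rcases eq_or_ne ξ 0 with rfl | hξ
    · obtain ⟨u, hu⟩ := NormedSpace.sphere_nonempty (E := E) (x := 0).2 zero_le_one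
      exact ⟨⟨u, hu⟩, by simp⟩
    · exact ⟨⟨‖ξ‖⁻¹ • ξ, by simp [norm_smul, hξ]⟩, smul_inv_smul₀ (norm_ne_zero_iff.2 hξ) ξ⟩
  exact hu ▸ congrFun (hsphere ‖ξ‖) u

end ScalarUncertainty

section UncertaintyPrinciples

variable {E : Type*} [NormedAddCommGroup E] [InnerProductSpace ℝ E]

theorem expMoment_clm_comp_le {X F F' : Type*} [MeasurableSpace X] {μ : Measure X}
    [NormedAddCommGroup F] [NormedSpace ℂ F] [NormedAddCommGroup F'] [NormedSpace ℂ F']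
    (T : F →L[ℂ] F') (l : X → ℝ) (f : X → F) :
    expMoment μ l (fun x => T (f x)) ≤ ‖T‖ₑ * expMoment μ l f := by
  rw [expMoment, expMoment, ← lintegral_const_mul' _ _ enorm_ne_top]
  refine lintegral_mono fun x => ?_
  rw [← mul_assoc]
  gcongr
  exact T.le_opENorm (f x)

theorem beurling_hormander [FiniteDimensional ℝ E] [Nontrivial E] [MeasurableSpace E]
    [BorelSpace E] {F : Type*} [NormedAddCommGroup F] [NormedSpace ℂ F] [CompleteSpace F]
    {f : E → F} (hf : Integrable f)
    (hfin : ∫⁻ ξ : E, ‖phaseIntegral volume (fun x => inner ℝ x ξ) f‖ₑ *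
      expMoment volume (fun x => inner ℝ x ξ) f < ⊤) :
    f =ᵐ[volume] 0 := by
  wlog hfm : StronglyMeasurable f generalizing f
  · obtain ⟨f', hf'm, hff'⟩ := hf.1
    simp only [phaseIntegral_congr_ae hff', expMoment_congr_ae hff'] at hfin
    exact hff'.trans (this (hf.congr hff') hfin hf'm)
  refine ae_eq_zero_of_phaseIntegral_inner_eq_zero hf fun ξ => ?_
  refine SeparatingDual.eq_zero_of_forall_dual_eq_zero (R := ℂ) fun T => ?_
  rw [← phaseIntegral_clm_comp T (by fun_prop) hf]
  refine phaseIntegral_inner_eq_zero (T.integrable_comp hf)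
    (T.continuous.comp_stronglyMeasurable hfm).measurable ?_ ξ
  calc ∫⁻ ξ : E, ‖phaseIntegral volume (fun x => inner ℝ x ξ) (fun x => T (f x))‖ₑ *
        expMoment volume (fun x => inner ℝ x ξ) (fun x => T (f x))
      ≤ ∫⁻ ξ : E, ‖T‖ₑ * ‖T‖ₑ * (‖phaseIntegral volume (fun x => inner ℝ x ξ) f‖ₑ *
          expMoment volume (fun x => inner ℝ x ξ) f) := by
        refine lintegral_mono fun ξ => ?_
        rw [phaseIntegral_clm_comp T (by fun_prop) hf, mul_mul_mul_comm]
        exact mul_le_mul' (T.le_opENorm _) (expMoment_clm_comp_le T _ f)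
    _ < ⊤ := by
        rw [lintegral_const_mul' _ _ (by finiteness)]
        exact ENNReal.mul_lt_top (by finiteness) hfin

theorem abs_inner_le_rpow_add_rpow {p q α β : ℝ} (hpq : p.HolderConjugate q) (hα : 0 < α)
    (hβ : 0 < β) (hαβ : 1 ≤ α * β) (x ξ : E) :
    |inner ℝ x ξ| ≤ α ^ p * ‖x‖ ^ p / p + β ^ q * ‖ξ‖ ^ q / q := by
  calc |inner ℝ x ξ| ≤ ‖x‖ * ‖ξ‖ := abs_real_inner_le_norm x ξ
    _ ≤ (α * β) * (‖x‖ * ‖ξ‖) := le_mul_of_one_le_left (by positivity) hαβ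
    _ = (α * ‖x‖) * (β * ‖ξ‖) := by ring
    _ ≤ (α * ‖x‖) ^ p / p + (β * ‖ξ‖) ^ q / q :=
        Real.young_inequality_of_nonneg (by positivity) (by positivity) hpq
    _ = α ^ p * ‖x‖ ^ p / p + β ^ q * ‖ξ‖ ^ q / q := by
        rw [Real.mul_rpow hα.le (norm_nonneg _), Real.mul_rpow hβ.le (norm_nonneg _)]

theorem expMoment_inner_le_of_holderConjugate [MeasurableSpace E] {μ : Measure E} {F : Type*}
    [NormedAddCommGroup F] {p q α β : ℝ} (hpq : p.HolderConjugate q) (hα : 0 < α) (hβ : 0 < β)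
    (hαβ : 1 ≤ α * β) (f : E → F) (ξ : E) :
    expMoment μ (fun x => inner ℝ x ξ) f ≤
      (∫⁻ x, ‖f x‖ₑ * ENNReal.ofReal (Real.exp (α ^ p * ‖x‖ ^ p / p)) ∂μ) *
        ENNReal.ofReal (Real.exp (β ^ q * ‖ξ‖ ^ q / q)) := by
  rw [expMoment, ← lintegral_mul_const' _ _ ENNReal.ofReal_ne_top]
  refine lintegral_mono fun x => ?_
  rw [mul_assoc, ← ENNReal.ofReal_mul (Real.exp_pos _).le, ← Real.exp_add]
  gcongr
  exact abs_inner_le_rpow_add_rpow hpq hα hβ hαβ x ξ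

theorem beurling_hormander_angularFourier {n : ℕ} (hn : 0 < n) {H : Type*}
    [NormedAddCommGroup H] [NormedSpace ℂ H] [CompleteSpace H] {f : EuclideanSpace ℝ (Fin n) → H}
    (hf : Integrable f)
    (hfin : ∫⁻ ξ, ‖angularFourier f ξ‖ₑ * expMoment volume (fun x => inner ℝ x ξ) f < ⊤) :
    f =ᵐ[volume] 0 := by
  have : Nonempty (Fin n) := ⟨⟨0, hn⟩⟩
  have hc : ((2 * Real.pi) ^ (-(n : ℝ) / 2) : ℝ) ≠ 0 := by positivity
  refine beurling_hormander hf ?_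
  have hangular (ξ : EuclideanSpace ℝ (Fin n)) : ‖angularFourier f ξ‖ₑ =
      ‖((2 * Real.pi) ^ (-(n : ℝ) / 2) : ℝ)‖ₑ *
        ‖phaseIntegral volume (fun x => inner ℝ x ξ) f‖ₑ := enorm_smul _ _
  simp only [hangular, mul_assoc] at hfin
  rw [lintegral_const_mul' _ _ enorm_ne_top] at hfin
  exact ENNReal.lt_top_of_mul_ne_top_right hfin.ne (enorm_ne_zero.2 hc)

theorem lemma2p1_general {n : ℕ} (hn : 0 < n)
    {H : Type*} [NormedAddCommGroup H] [NormedSpace ℂ H] [CompleteSpace H]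
    (f : EuclideanSpace ℝ (Fin n) → H) (hf : MemLp f 1 volume) :
    ((∫⁻ ξ, ∫⁻ x, ‖f x‖ₑ * ‖angularFourier f ξ‖ₑ *
          ENNReal.ofReal (Real.exp |inner ℝ x ξ|)) < ⊤ →
        f =ᵐ[volume] 0) ∧
    (∀ p q α β : ℝ, 1 < p → 1 / p + 1 / q = 1 → 0 < α → 0 < β → 1 ≤ α * β →
        (∫⁻ x, ‖f x‖ₑ * ENNReal.ofReal (Real.exp (α ^ p * ‖x‖ ^ p / p))) +
          (∫⁻ ξ, ‖angularFourier f ξ‖ₑ *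
            ENNReal.ofReal (Real.exp (β ^ q * ‖ξ‖ ^ q / q))) < ⊤ →
        f =ᵐ[volume] 0) := by
  have hf' : Integrable f := memLp_one_iff_integrable.1 hf
  refine ⟨fun hfin => beurling_hormander_angularFourier hn hf' ?_,
    fun p q α β hp hpq hα hβ hαβ hfin => beurling_hormander_angularFourier hn hf' ?_⟩
  · simp only [mul_right_comm _ ‖angularFourier f _‖ₑ, lintegral_mul_const' _ _ enorm_ne_top]
      at hfin
    simpa only [expMoment, mul_comm] using hfin
  · obtain ⟨hf_fin, hfourier_fin⟩ := ENNReal.add_lt_top.1 hfin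
    have hpq' : p.HolderConjugate q :=
      Real.holderConjugate_iff.2 ⟨hp, by simpa only [one_div] using hpq⟩
    refine lt_of_le_of_lt ?_ (ENNReal.mul_lt_top hf_fin hfourier_fin)
    rw [← lintegral_const_mul' _ _ hf_fin.ne]
    refine lintegral_mono fun ξ => ?_
    rw [mul_left_comm]
    gcongr
    exact expMoment_inner_le_of_holderConjugate hpq' hα hβ hαβ f ξ

end UncertaintyPrinciples

theorem lemma2p1 {n : ℕ} (hn : 0 < n)
    {H : Type*} [NormedAddCommGroup H] [InnerProductSpace ℂ H] [CompleteSpace H]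
    (f : EuclideanSpace ℝ (Fin n) → H)
    (hf1 : MemLp f 1 volume) (hf2 : MemLp f 2 volume) :
    ((∫⁻ ξ, ∫⁻ x, ‖f x‖ₑ * ‖angularFourier f ξ‖ₑ *
          ENNReal.ofReal (Real.exp |inner ℝ x ξ|)) < ⊤ →
        f =ᵐ[volume] 0) ∧
    (∀ p q α β : ℝ, 1 < p → p < 2 → 1 / p + 1 / q = 1 → 0 < α → 0 < β → 1 < α * β →
        (∫⁻ x, ‖f x‖ₑ * ENNReal.ofReal (Real.exp (α ^ p * ‖x‖ ^ p / p))) +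
          (∫⁻ ξ, ‖angularFourier f ξ‖ₑ *
            ENNReal.ofReal (Real.exp (β ^ q * ‖ξ‖ ^ q / q))) < ⊤ →
        f =ᵐ[volume] 0) :=
  (lemma2p1_general hn f hf1).imp_right fun h p q α β hp _ hpq hα hβ hαβ =>
    h p q α β hp hpq hα hβ hαβ.le
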